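/- All graphs are finite, simple and undirected. For a vertex $v$ of a graph $G$ let $N(v)$ be its open neighbourhood and $N[v]=N(v)\cup\{v\}$ its closed neighbourhood. The graph $G$ is twin-free if no two distinct vertices have the same open neighbourhood and no two distinct vertices have the same closed neighbourhood. A total dominating identifying code of $G$ is a set $C\subseteq V(G)$ such that every vertex of $G$ has a neighbour in $C$ and $N[u]\cap C\neq N[v]\cap C$ for all distinct vertices $u,v$ of $G$; the smallest size of such a set is denoted by $\gamma_t^{\mathrm{ID}}(G)$. Theorem. Let $G$ be a connected twin-free graph of girth at least $5$ on $n\geq 3$ vertices (the girth is the length of a shortest cycle, and is $\infty$ if $G$ has no cycle). Then $G$ has a total dominating identifying code, and $$\gamma_t^{\mathrm{ID}}(G)\leq \frac{3n}{4}.$$ -/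

import Mathlib

namespace TotalDomIdCode

/-- The closed neighbourhood `N[v] = N(v) ∪ {v}`. -/
def closedNbhd {V : Type*} (G : SimpleGraph V) (v : V) : Set V :=
  G.neighborSet v ∪ {v}

/-- The `I`-set of `v` with respect to the code `C`: `I(v) = N[v] ∩ C`. -/
def iSet {V : Type*} (G : SimpleGraph V) (C : Finset V) (v : V) : Set V :=
  closedNbhd G v ∩ (C : Set V)

/-- Distinct vertices with the same open neighbourhood. -/
def OpenTwins {V : Type*} (G : SimpleGraph V) (u v : V) : Prop :=
  u ≠ v ∧ G.neighborSet u = G.neighborSet v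

/-- Distinct vertices with the same closed neighbourhood. -/
def ClosedTwins {V : Type*} (G : SimpleGraph V) (u v : V) : Prop :=
  u ≠ v ∧ closedNbhd G u = closedNbhd G v

/-- A graph is twin-free if it has neither open nor closed twins. -/
def TwinFree {V : Type*} (G : SimpleGraph V) : Prop :=
  ∀ u v : V, ¬ OpenTwins G u v ∧ ¬ ClosedTwins G u v

/-- A code is separating if distinct vertices have distinct `I`-sets. -/
def IsSeparatingCode {V : Type*} (G : SimpleGraph V) (C : Finset V) : Prop :=
  ∀ u v : V, u ≠ v → iSet G C u ≠ iSet G C v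

/-- Every vertex has a neighbour in the set. -/
def IsTotalDominatingSet {V : Type*} (G : SimpleGraph V) (C : Finset V) : Prop :=
  ∀ v : V, ∃ c ∈ C, G.Adj v c

/-- A total dominating identifying code: a separating code that is a total dominating set. -/
def IsTotalDominatingIdentifyingCode {V : Type*} (G : SimpleGraph V) (C : Finset V) : Prop :=
  IsSeparatingCode G C ∧ IsTotalDominatingSet G C

/-- The smallest size of a total dominating identifying code of `G`
(meaningful only if such a code exists). -/
noncomputable def gammaTID {V : Type*} (G : SimpleGraph V) : ℕ :=
  sInf {k : ℕ | ∃ C : Finset V, IsTotalDominatingIdentifyingCode G C ∧ C.card = k}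

end TotalDomIdCode

/-!
In a graph without triangles and 4-cycles, a totally dominating set `C` is an identifying code as
soon as no component of `G[C]` is a single edge and every `w ∈ C` has at most one *private*
vertex, that is, a vertex outside `C` whose only neighbour in `C` is `w` (`IsGood.isCode`). The
whole vertex set is such a good set. Among the good sets `C` of minimum size, fix one with the
largest number of edges in `G[C]`; the bound follows by distributing `C` over its complement so
that each vertex outside `C` receives at most three vertices of `C`.

Call `w ∈ C` an owner if it has a private vertex, and call `c ∈ C` marked by `d ∉ C` if `d` is
private to `c`, or if `c` is not an owner and the neighbours of `d` in `C` are `c` and one owner.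
In both cases `d` may prevent the removal of `c` from `C`, and `d` marks only one vertex. An
unmarked `c` cannot be removed either, since `C` has minimum size, and the only possible
obstructions (`IsOptimal.removal`) are a leaf of `G[C]` attached to `c`, a two-vertex path of
`G[C]` hanging from `c`, or `c` being itself a leaf of `G[C]` attached to an owner `w`.

In the first two cases a marked vertex occurs within the pendant piece, unless `c` lies on a
component of `G[C]` that is a path on three vertices; such a component contains a marked vertex as
well (`IsOptimal.exists_marked_of_isPathComp`), and `c` is charged to a vertex marking it. In the
third case `c` is charged to a private vertex of `w` if `w` is its only neighbour in `G`, which by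
twin-freeness happens at most once for each `w`. Otherwise `c` has a neighbour `x ∉ C`. A path
component is treated as before; outside of these, `c` is charged to `x`: if `x` had a third
neighbour in `C`, exchanging the leaf `c` for `x` would produce a good set of the same size with
more edges (`IsOptimal.swap`). So `x` has exactly two neighbours in `C`, it marks nothing, and it
receives at most two charges.
-/

namespace TotalDomIdCode

open Finset

/-! ### Good sets, owners and marks -/

open Classical in
/-- The neighbours of `v` inside the code `C`. -/
noncomputable def codeNbrs {V : Type*} (G : SimpleGraph V) (C : Finset V) (v : V) : Finset V :=
  {u ∈ C | G.Adj v u}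

/-- A set `C` is good if it is totally dominating (`dom`), no component of `G[C]` is a single edge
(`big`), and distinct vertices outside `C` never have the same single neighbour in `C` (`priv`).
For graphs of girth at least 5 every good set is a total dominating identifying code. -/
structure IsGood {V : Type*} (G : SimpleGraph V) (C : Finset V) : Prop where
  dom : ∀ v, (codeNbrs G C v).Nonempty
  big : ∀ u ∈ C, ∀ v ∈ C, codeNbrs G C u = {v} → codeNbrs G C v ≠ {u}
  priv : ∀ w u v, u ∉ C → v ∉ C → codeNbrs G C u = {w} → codeNbrs G C v = {w} → u = v

/-- `w` is the only neighbour in `C` of some vertex outside `C`. -/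
def Owner {V : Type*} (G : SimpleGraph V) (C : Finset V) (w : V) : Prop :=
  ∃ y, y ∉ C ∧ codeNbrs G C y = {w}

open Classical in
/-- The vertex `d ∉ C` marks `c`: either `d` is dominated by `c` alone, or removing a non-owner `c`
from `C` would leave `d` dominated only by a vertex that already has a private vertex. -/
def Marks {V : Type*} (G : SimpleGraph V) (C : Finset V) (d c : V) : Prop :=
  d ∉ C ∧ (codeNbrs G C d = {c} ∨ ¬ Owner G C c ∧ ∃ w, Owner G C w ∧ codeNbrs G C d = {c, w})

/-- `c` is marked by some vertex outside `C`. -/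
def Marked {V : Type*} (G : SimpleGraph V) (C : Finset V) (c : V) : Prop :=
  ∃ d, Marks G C d c

/-- The degree sum of `G[C]`, which is twice its number of edges. -/
noncomputable def degSum {V : Type*} (G : SimpleGraph V) (C : Finset V) : ℕ :=
  ∑ v ∈ C, (codeNbrs G C v).card

variable {V : Type*} {G : SimpleGraph V} {C : Finset V}

@[simp] theorem mem_codeNbrs {u v : V} : u ∈ codeNbrs G C v ↔ u ∈ C ∧ G.Adj v u := by
  classical
  simp [codeNbrs]

theorem codeNbrs_eq_singleton {v w : V} :
    codeNbrs G C v = {w} ↔ (w ∈ C ∧ G.Adj v w) ∧ ∀ u ∈ C, G.Adj v u → u = w := by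
  simp only [Finset.eq_singleton_iff_unique_mem, mem_codeNbrs, and_imp]

open Classical in
theorem codeNbrs_eq_pair {v w z : V} :
    codeNbrs G C v = {w, z} ↔ (w ∈ C ∧ G.Adj v w) ∧ (z ∈ C ∧ G.Adj v z) ∧
      ∀ u ∈ C, G.Adj v u → u = w ∨ u = z := by
  constructor
  · intro h
    refine ⟨?_, ?_, fun u hu hv => ?_⟩
    · rw [← mem_codeNbrs, h]; simp
    · rw [← mem_codeNbrs, h]; simp
    · have : u ∈ codeNbrs G C v := mem_codeNbrs.2 ⟨hu, hv⟩
      rw [h] at this; simpa using this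
  · rintro ⟨h1, h2, h3⟩
    ext u
    simp only [mem_codeNbrs, mem_insert, mem_singleton]
    constructor
    · rintro ⟨a, b⟩; exact h3 u a b
    · rintro (rfl | rfl) <;> assumption

open Classical in
theorem card_codeNbrs_insert {x : V} (hx : x ∉ C) (v : V) :
    (codeNbrs G (insert x C) v).card = (codeNbrs G C v).card + if G.Adj v x then 1 else 0 := by
  unfold codeNbrs
  rw [Finset.filter_insert]
  split_ifs with h
  · rw [Finset.card_insert_of_notMem (by simp [hx])]
  · rfl

open Classical in
theorem degSum_insert {x : V} (hx : x ∉ C) :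
    degSum G (insert x C) = degSum G C + 2 * (codeNbrs G C x).card := by
  unfold degSum
  rw [Finset.sum_insert hx, card_codeNbrs_insert hx,
    Finset.sum_congr rfl (fun v _ => card_codeNbrs_insert (G := G) hx v), Finset.sum_add_distrib,
    ← Finset.card_filter]
  have : ({v ∈ C | G.Adj v x} : Finset V) = codeNbrs G C x := by
    ext; simp [G.adj_comm]
  rw [this]
  simp
  ring

/-! ### Girth at least five -/

theorem no_triangle (hg : 5 ≤ G.egirth) {a b c : V} (hab : G.Adj a b) (hbc : G.Adj b c)
    (hca : G.Adj c a) : False := by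
  have hcyc : (SimpleGraph.Walk.cons hab (.cons hbc (.cons hca .nil))).IsCycle := by
    have := hab.ne; have := hbc.ne; have := hca.ne
    rw [SimpleGraph.Walk.cons_isCycle_iff]
    simp [SimpleGraph.Walk.cons_isPath_iff, *, Ne.symm]
  have := SimpleGraph.le_egirth.1 hg _ _ hcyc
  simp at this
  norm_cast at this

/-- Two distinct vertices have at most one common neighbour. -/
theorem no_square (hg : 5 ≤ G.egirth) {a b u v : V} (hab : a ≠ b) (huv : u ≠ v)
    (h1 : G.Adj a u) (h2 : G.Adj a v) (h3 : G.Adj b u) (h4 : G.Adj b v) : False := by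
  have hcyc : (SimpleGraph.Walk.cons h1 (.cons h3.symm (.cons h4 (.cons h2.symm .nil)))).IsCycle := by
    have := h1.ne; have := h2.ne; have := h3.ne; have := h4.ne
    rw [SimpleGraph.Walk.cons_isCycle_iff]
    simp [SimpleGraph.Walk.cons_isPath_iff, *, Ne.symm]
  have := SimpleGraph.le_egirth.1 hg _ _ hcyc
  simp at this
  norm_cast at this

/-! ### Good sets are codes -/

theorem IsGood.isCode (hg : 5 ≤ G.egirth) (h : IsGood G C) :
    IsTotalDominatingIdentifyingCode G C := by
  refine ⟨fun u v huv heq => ?_, fun v => ?_⟩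
  · have key : ∀ c ∈ C, (G.Adj u c ∨ c = u) ↔ (G.Adj v c ∨ c = v) := by
      intro c hc
      have := Set.ext_iff.1 heq c
      simpa [iSet, closedNbhd, hc, or_comm] using this
    obtain ⟨a, ha⟩ := h.dom u
    obtain ⟨b, hb⟩ := h.dom v
    rw [mem_codeNbrs] at ha hb
    by_cases hadj : G.Adj u v
    -- By triangle-freeness both `I`-sets are `{u, v}`, so `uv` would be an isolated edge of `G[C]`.
    · have hu : ∀ c ∈ C, G.Adj u c → c = v := fun c hc huc => by
        rcases (key c hc).1 (.inl huc) with h' | h'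
        · exact (no_triangle hg hadj h' huc.symm).elim
        · exact h'
      have hv : ∀ c ∈ C, G.Adj v c → c = u := fun c hc hvc => by
        rcases (key c hc).2 (.inl hvc) with h' | h'
        · exact (no_triangle hg hadj hvc h'.symm).elim
        · exact h'
      obtain rfl := hu a ha.1 ha.2
      obtain rfl := hv b hb.1 hb.2
      exact h.big b hb.1 a ha.1 (codeNbrs_eq_singleton.2 ⟨ha, hu⟩)
        (codeNbrs_eq_singleton.2 ⟨hb, hv⟩)
    -- Otherwise neither vertex is in `C` and they share a single neighbour there.
    · have hu : u ∉ C := fun hu => by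
        rcases (key u hu).1 (.inr rfl) with h' | h'
        · exact hadj h'.symm
        · exact huv h'
      have hv : v ∉ C := fun hv => by
        rcases (key v hv).2 (.inr rfl) with h' | h'
        · exact hadj h'
        · exact huv h'.symm
      have hva : ∀ c ∈ C, G.Adj u c → G.Adj v c := fun c hc huc =>
        ((key c hc).1 (.inl huc)).resolve_right (by rintro rfl; exact hv hc)
      have hua : ∀ c ∈ C, G.Adj v c → G.Adj u c := fun c hc hvc =>
        ((key c hc).2 (.inl hvc)).resolve_right (by rintro rfl; exact hu hc)
      have hun : ∀ c ∈ C, G.Adj u c → c = a := fun c hc huc => by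
        by_contra hne
        exact no_square hg huv hne huc ha.2 (hva c hc huc) (hva a ha.1 ha.2)
      exact huv (h.priv a u v hu hv (codeNbrs_eq_singleton.2 ⟨ha, hun⟩)
        (codeNbrs_eq_singleton.2 ⟨⟨ha.1, hva a ha.1 ha.2⟩,
          fun c hc hvc => hun c hc (hua c hc hvc)⟩))
  · obtain ⟨a, ha⟩ := h.dom v
    rw [mem_codeNbrs] at ha
    exact ⟨a, ha.1, ha.2⟩

theorem isGood_univ [Fintype V] (hn : 3 ≤ Fintype.card V) (hconn : G.Connected)
    (htwin : TwinFree G) : IsGood G Finset.univ := by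
  have : Nontrivial V := Fintype.one_lt_card_iff_nontrivial.1 (by omega)
  refine ⟨fun v => ?_, fun u _ v _ hu hv => ?_, fun w u v hu => by simp at hu⟩
  · obtain ⟨w, hw⟩ := hconn.preconnected.exists_adj_of_nontrivial v
    exact ⟨w, by simpa using hw⟩
  · rw [codeNbrs_eq_singleton] at hu hv
    refine (htwin u v).2 ⟨hu.1.2.ne, ?_⟩
    ext z
    simp only [closedNbhd, Set.mem_union, SimpleGraph.mem_neighborSet, Set.mem_singleton_iff]
    have := hu.2 z (mem_univ _); have := hv.2 z (mem_univ _)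
    have := hu.1.2; have := hv.1.2
    constructor <;> rintro (h | rfl) <;> grind

/-! ### Removing an unmarked vertex -/

theorem Marked.of_owner {c : V} (h : Owner G C c) : Marked G C c :=
  let ⟨y, hy, hyc⟩ := h
  ⟨y, hy, .inl hyc⟩

open Classical in
/-- Deleting an unmarked vertex `c` from `C`, and adding arbitrary vertices, creates no two outside
vertices with the same single code neighbour, as long as `c` itself is not left with an owner as
its only neighbour. -/
theorem IsGood.priv_erase_union (hg : 5 ≤ G.egirth) (h : IsGood G C) {c : V} (hc : ¬ Marked G C c)
    {C' : Finset V} (hC' : C.erase c ⊆ C')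
    (hw : ∀ w, codeNbrs G C' c = {w} → ¬ Owner G C w) (w u v : V) (hu : u ∉ C') (hv : v ∉ C')
    (hu' : codeNbrs G C' u = {w}) (hv' : codeNbrs G C' v = {w}) : u = v := by
  -- An outside vertex other than `c` that sees only `w` now saw only `w`, or `c` and `w`, before.
  have key : ∀ z, z ∉ C' → z ≠ c → codeNbrs G C' z = {w} →
      z ∉ C ∧ (codeNbrs G C z = {w} ∨ codeNbrs G C z = {c, w}) := by
    intro z hz hzc hzw
    have hzC : z ∉ C := fun hzC => hz (hC' (mem_erase.2 ⟨hzc, hzC⟩))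
    refine ⟨hzC, ?_⟩
    rw [codeNbrs_eq_singleton] at hzw
    have hsub : ∀ e ∈ C, G.Adj z e → e = c ∨ e = w := fun e he hze => by
      by_cases hec : e = c
      · exact .inl hec
      · exact .inr (hzw.2 e (hC' (mem_erase.2 ⟨hec, he⟩)) hze)
    have hwC : w ∈ C := by
      by_contra hwC
      obtain ⟨e, he⟩ := h.dom z
      rw [mem_codeNbrs] at he
      refine hc ⟨z, hzC, .inl (codeNbrs_eq_singleton.2 ⟨?_, fun e' he' hz' => ?_⟩)⟩
      · rcases hsub e he.1 he.2 with rfl | rfl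
        · exact he
        · exact (hwC he.1).elim
      · rcases hsub e' he' hz' with rfl | rfl
        · rfl
        · exact (hwC he').elim
    by_cases hzc' : c ∈ C ∧ G.Adj z c
    · exact .inr (codeNbrs_eq_pair.2 ⟨hzc', ⟨hwC, hzw.1.2⟩, hsub⟩)
    · refine .inl (codeNbrs_eq_singleton.2 ⟨⟨hwC, hzw.1.2⟩, fun e he hze => ?_⟩)
      rcases hsub e he hze with rfl | rfl
      · exact (hzc' ⟨he, hze⟩).elim
      · rfl
  have hblock : ∀ z, z ∉ C → codeNbrs G C z = {c, w} → ¬ Owner G C w := fun z hz hzw how =>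
    hc ⟨z, hz, .inr ⟨fun hco => hc (.of_owner hco), w, how, hzw⟩⟩
  have hself : ∀ z, z ≠ c → z ∉ C' → codeNbrs G C' z = {w} → codeNbrs G C' c ≠ {w} := by
    intro z hzc hz hzw hcw
    obtain ⟨hzC, h1 | h1⟩ := key z hz hzc hzw
    · exact hw w hcw ⟨z, hzC, h1⟩
    · rw [codeNbrs_eq_pair] at h1
      rw [codeNbrs_eq_singleton] at hcw
      exact no_triangle hg h1.1.2 hcw.1.2 h1.2.1.2.symm
  by_contra huv
  by_cases huc : u = c
  · subst huc
    exact hself v (Ne.symm huv) hv hv' hu'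
  by_cases hvc : v = c
  · subst hvc
    exact hself u huv hu hu' hv'
  obtain ⟨huC, h1 | h1⟩ := key u hu huc hu' <;> obtain ⟨hvC, h2 | h2⟩ := key v hv hvc hv'
  · exact huv (h.priv w u v huC hvC h1 h2)
  · exact hblock v hvC h2 ⟨u, huC, h1⟩
  · exact hblock u huC h1 ⟨v, hvC, h2⟩
  · have hcw : c ≠ w := fun hcw => by
      subst hcw
      exact hc ⟨u, huC, .inl (by simpa using h1)⟩
    rw [codeNbrs_eq_pair] at h1 h2
    exact no_square hg huv hcw h1.1.2 h1.2.1.2 h2.1.2 h2.2.1.2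

/-- A good set of minimum size which, among these, spans the largest number of edges. -/
structure IsOptimal (G : SimpleGraph V) (C : Finset V) : Prop extends IsGood G C where
  card_le : ∀ C', IsGood G C' → C.card ≤ C'.card
  degSum_le : ∀ C', IsGood G C' → C'.card = C.card → degSum G C' ≤ degSum G C

theorem IsGood.exists_isOptimal [Fintype V] (h : IsGood G C) : ∃ C, IsOptimal G C := by
  classical
  obtain ⟨C₀, h0, hmin⟩ := Finset.exists_min_image {C : Finset V | IsGood G C} Finset.card
    ⟨C, by simpa using h⟩
  obtain ⟨C₁, h1, hmax⟩ := Finset.exists_max_image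
    {C : Finset V | IsGood G C ∧ C.card = C₀.card} (degSum G) ⟨C₀, by simpa using h0⟩
  simp only [mem_filter, mem_univ, true_and] at h0 hmin h1 hmax
  exact ⟨C₁, h1.1, fun C' h' => h1.2 ▸ hmin C' h', fun C' h' hc => hmax C' ⟨h', hc.trans h1.2⟩⟩

open Classical in
/-- The vertices `a`, `b`, `c` form, in this order, a path that is a component of `G[C]`; the
vertices are not required to lie in `C`, as this follows from the equations. -/
def IsPathComp (G : SimpleGraph V) (C : Finset V) (a b c : V) : Prop :=
  a ≠ c ∧ codeNbrs G C a = {b} ∧ codeNbrs G C b = {a, c} ∧ codeNbrs G C c = {b}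

theorem IsPathComp.symm {a b c : V} (h : IsPathComp G C a b c) : IsPathComp G C c b a := by
  classical
  exact ⟨h.1.symm, h.2.2.2, by rw [h.2.2.1, Finset.pair_comm], h.2.1⟩

open Classical in
/-- The reasons why an unmarked vertex `c` cannot be removed from an optimal set: a leaf `s` of
`G[C]` at `c`, a path `c`, `s`, `t` of `G[C]` with pendant end `st`, or `c` being a leaf of `G[C]`
at an owner. -/
theorem IsOptimal.removal (hg : 5 ≤ G.egirth) (h : IsOptimal G C) {c : V} (hcC : c ∈ C)
    (hc : ¬ Marked G C c) :
    (∃ s, codeNbrs G C s = {c} ∧ s ∈ C) ∨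
    (∃ s t, codeNbrs G C s = {t, c} ∧ codeNbrs G C t = {s} ∧ t ≠ c) ∨
    (∃ w, Owner G C w ∧ codeNbrs G C c = {w}) := by
  by_contra! hcon
  obtain ⟨h1, h2, h3⟩ := hcon
  have herase : ∀ z w, codeNbrs G (C.erase c) z = {w} ↔
      w ≠ c ∧ (w ∈ C ∧ G.Adj z w) ∧ ∀ u ∈ C, G.Adj z u → u ≠ c → u = w := by
    intro z w; rw [codeNbrs_eq_singleton]; simp only [mem_erase]; grind
  have hgood : IsGood G (C.erase c) := by
    refine ⟨fun v => ?_, fun u hu v hv huv hvu => ?_, ?_⟩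
    · by_contra hne
      have : ∀ e ∈ C, G.Adj v e → e = c := fun e he hve => by
        by_contra hec
        exact hne ⟨e, by simp [he, hve, hec]⟩
      obtain ⟨e, he⟩ := h.dom v
      rw [mem_codeNbrs] at he
      obtain rfl := this e he.1 he.2
      have hs := codeNbrs_eq_singleton.2 ⟨he, this⟩
      by_cases hv : v ∈ C
      · exact h1 v hs hv
      · exact hc ⟨v, hv, .inl hs⟩
    · rw [mem_erase] at hu hv
      rw [herase] at huv hvu
      have hadj := huv.2.1.2
      -- At least one of `u`, `v` loses the neighbour `c`, and by triangle-freeness not both.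
      by_cases hcu : G.Adj u c
      · have hcv : ¬ G.Adj v c := fun hcv => no_triangle hg hadj hcv hcu.symm
        exact hv.1 <| h2 u v (codeNbrs_eq_pair.2 ⟨⟨hv.2, hadj⟩, ⟨hcC, hcu⟩, fun e he hue => by grind⟩)
          (codeNbrs_eq_singleton.2 ⟨⟨hu.2, hadj.symm⟩, fun e he hve => by grind⟩)
      · have hcu' := codeNbrs_eq_singleton.2
          ⟨⟨hv.2, hadj⟩, fun e he hue => huv.2.2 e he hue (by rintro rfl; exact hcu hue)⟩
        by_cases hcv : G.Adj v c
        · exact hu.1 <| h2 v u (codeNbrs_eq_pair.2 ⟨⟨hu.2, hadj.symm⟩, ⟨hcC, hcv⟩,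
            fun e he hue => by grind⟩) hcu'
        · exact h.big u hu.2 v hv.2 hcu' (codeNbrs_eq_singleton.2 ⟨⟨hu.2, hadj.symm⟩,
            fun e he hve => hvu.2.2 e he hve (by rintro rfl; exact hcv hve)⟩)
    · refine h.toIsGood.priv_erase_union hg hc subset_rfl (fun w hw ho => h3 w ho ?_)
      rw [herase] at hw
      exact codeNbrs_eq_singleton.2 ⟨hw.2.1, fun e he hce => hw.2.2 e he hce hce.ne'⟩
  have := h.card_le _ hgood
  have := Finset.card_erase_lt_of_mem hcC
  omega

open Classical in
/-- Exchanging an unmarked leaf `c` of `G[C]` for a vertex `x ∉ C` with two neighbours in `C` other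
than `c` preserves the size and gains edges, so in an optimal set the result is not good. The
remaining hypotheses would make it good: `hown` ensures that `c` does not become a second private
vertex of `w`, and `hpath` that a path component `v`, `w`, `c` is not reduced to the isolated edge
`vw`. -/
theorem IsOptimal.swap (hg : 5 ≤ G.egirth) (h : IsOptimal G C) {c w x : V} (hcC : c ∈ C)
    (hc : ¬ Marked G C c) (hcw : codeNbrs G C c = {w}) (hx : x ∉ C)
    (hdeg : 2 ≤ (codeNbrs G (C.erase c) x).card)
    (hown : Owner G C w → G.Adj x c)
    (hpath : ∀ v, codeNbrs G C v = {w} → codeNbrs G C w = {v, c} → G.Adj x v) : False := by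
  set C' := insert x (C.erase c) with hC'
  have hxe : x ∉ C.erase c := fun hxe => hx (mem_of_mem_erase hxe)
  have hxc : x ≠ c := by rintro rfl; exact hx hcC
  have hcw' := codeNbrs_eq_singleton.1 hcw
  have hgood : IsGood G C' := by
    have hmem : ∀ e, e ∈ C' ↔ e = x ∨ e ≠ c ∧ e ∈ C := fun e => by simp [hC']
    have hx2 : ∀ v, codeNbrs G C' x ≠ {v} := fun v hv => by
      have := Finset.card_le_card (s := codeNbrs G (C.erase c) x) (t := codeNbrs G C' x)
        fun e he => by
          rw [mem_codeNbrs] at he ⊢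
          exact ⟨mem_insert_of_mem he.1, he.2⟩
      rw [hv, card_singleton] at this
      omega
    -- an isolated edge of the new code comes from an old path on three vertices ending in `c`
    have hold : ∀ u v, v ≠ c → codeNbrs G C' u = {v} →
        codeNbrs G C' v = {u} → G.Adj u c → u ∈ C → v ∈ C → False := by
      intro u v hvc huv hvu huc hu hv
      obtain rfl := hcw'.2 u hu huc.symm
      rw [codeNbrs_eq_singleton] at huv hvu
      have hvc' : ¬ G.Adj v c := fun h' => huv.1.2.ne (hcw'.2 v hv h'.symm).symm
      have hxv := hpath v
        (codeNbrs_eq_singleton.2 ⟨⟨hu, hvu.1.2⟩, fun e he hve => hvu.2 e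
          ((hmem e).2 (.inr ⟨by rintro rfl; exact hvc' hve, he⟩)) hve⟩)
        (codeNbrs_eq_pair.2 ⟨⟨hv, huv.1.2⟩, ⟨hcC, huc⟩, fun e he hue => by
          by_cases hec : e = c
          · exact .inr hec
          · exact .inl (huv.2 e ((hmem e).2 (.inr ⟨hec, he⟩)) hue)⟩)
      exact hx (hvu.2 x ((hmem x).2 (.inl rfl)) hxv.symm ▸ hu)
    refine ⟨fun v => ?_, fun u hu v hv huv hvu => ?_, ?_⟩
    · by_cases hvx : v = x
      · obtain ⟨e, he⟩ := Finset.card_pos.1 (by omega : 0 < (codeNbrs G (C.erase c) x).card)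
        rw [mem_codeNbrs] at he
        exact ⟨e, mem_codeNbrs.2 ⟨mem_insert_of_mem he.1, hvx ▸ he.2⟩⟩
      by_contra hne
      have : ∀ e ∈ C, G.Adj v e → e = c := fun e he hve => by
        by_contra hec
        exact hne ⟨e, mem_codeNbrs.2 ⟨(hmem e).2 (.inr ⟨hec, he⟩), hve⟩⟩
      obtain ⟨e, he⟩ := h.dom v
      rw [mem_codeNbrs] at he
      obtain rfl := this e he.1 he.2
      have hs := codeNbrs_eq_singleton.2 ⟨he, this⟩
      by_cases hv : v ∈ C
      · obtain rfl := hcw'.2 v hv he.2.symm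
        exact h.big _ hv _ hcC hs hcw
      · exact hc ⟨v, hv, .inl hs⟩
    · rcases (hmem u).1 hu with rfl | ⟨huc, huC⟩
      · exact hx2 _ huv
      rcases (hmem v).1 hv with rfl | ⟨hvc, hvC⟩
      · exact hx2 _ hvu
      by_cases h1 : G.Adj u c
      · exact hold u v hvc huv hvu h1 huC hvC
      by_cases h2 : G.Adj v c
      · exact hold v u huc hvu huv h2 hvC huC
      rw [codeNbrs_eq_singleton] at huv hvu
      exact h.big u huC v hvC
        (codeNbrs_eq_singleton.2 ⟨⟨hvC, huv.1.2⟩, fun e he hue => huv.2 e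
          ((hmem e).2 (.inr ⟨by rintro rfl; exact h1 hue, he⟩)) hue⟩)
        (codeNbrs_eq_singleton.2 ⟨⟨huC, hvu.1.2⟩, fun e he hve => hvu.2 e
          ((hmem e).2 (.inr ⟨by rintro rfl; exact h2 hve, he⟩)) hve⟩)
    · refine h.toIsGood.priv_erase_union hg hc (subset_insert _ _) (fun z hz ho => ?_)
      rw [codeNbrs_eq_singleton] at hz
      obtain rfl := hz.2 w ((hmem w).2 (.inr ⟨hcw'.1.2.ne', hcw'.1.1⟩)) hcw'.1.2
      exact hx (hz.2 x ((hmem x).2 (.inl rfl)) (hown ho).symm ▸ hcw'.1.1)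
  have hcard : C'.card = C.card := by
    rw [hC', Finset.card_insert_of_notMem hxe, Finset.card_erase_add_one hcC]
  have h1 := h.degSum_le C' hgood hcard
  have h2 := degSum_insert (G := G) hxe
  rw [← hC'] at h2
  have h3 := degSum_insert (G := G) (Finset.notMem_erase c C)
  rw [Finset.insert_erase hcC] at h3
  have h4 : (codeNbrs G (C.erase c) c).card ≤ (codeNbrs G C c).card :=
    Finset.card_le_card fun e he => by simp at he ⊢; tauto
  rw [hcw, Finset.card_singleton] at h4
  omega


/-- If no vertex of a path component `a`, `b`, `c` is marked, then any further neighbour `x` of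
one end only could be exchanged for the other end. Hence the ends have the same neighbours, which
contradicts twin-freeness. -/
theorem IsOptimal.exists_marked_of_isPathComp (hg : 5 ≤ G.egirth) (htwin : TwinFree G)
    (h : IsOptimal G C) {a b c : V} (hP : IsPathComp G C a b c) :
    Marked G C a ∨ Marked G C b ∨ Marked G C c := by
  classical
  by_contra! hcon
  obtain ⟨ha, hb, hc⟩ := hcon
  have key : ∀ a c, IsPathComp G C a b c → ¬ Marked G C a → ¬ Marked G C c →
      ∀ x, G.Adj a x → G.Adj c x := by
    intro a c hP ha hc x hax
    by_contra hcx
    obtain ⟨hac, h1, h2, h3⟩ := hP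
    have h1' := codeNbrs_eq_singleton.1 h1
    have h2' := codeNbrs_eq_pair.1 h2
    have h3' := codeNbrs_eq_singleton.1 h3
    have hxC : x ∉ C := fun hxC => hcx (h1'.2 x hxC hax ▸ h3'.1.2)
    refine h.swap hg h2'.2.1.1 hc h3 hxC ?_ (fun ho => (hb (.of_owner ho)).elim) fun v _ hbv => ?_
    -- As `a` is unmarked, `x` is not private to `a`, so it has a second neighbour in `C`.
    · by_contra! hlt
      refine ha ⟨x, hxC, .inl (codeNbrs_eq_singleton.2 ⟨⟨h2'.1.1, hax.symm⟩, fun e he hxe => ?_⟩)⟩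
      refine Finset.card_le_one.1 (Nat.le_of_lt_succ hlt) e ?_ a ?_
      · simp only [mem_codeNbrs, mem_erase]
        exact ⟨⟨by rintro rfl; exact hcx hxe.symm, he⟩, hxe⟩
      · simp only [mem_codeNbrs, mem_erase]
        exact ⟨⟨hac, h2'.1.1⟩, hax.symm⟩
    · have : a ∈ codeNbrs G C b := mem_codeNbrs.2 h2'.1
      rw [hbv] at this
      simp only [mem_insert, mem_singleton] at this
      rw [← this.resolve_right hac]
      exact hax.symm
  refine (htwin a c).1 ⟨hP.1, Set.ext fun x => ⟨key a c hP ha hc x, key c a hP.symm hc ha x⟩⟩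

/-! ### Charging the code to its complement -/

open Classical in
/-- The vertices `c` of `C` that may be charged to a vertex marking `m`: `m` itself, the vertices
of degree one in `G` attached to `m`, the neighbours of `m` in `G[C]` if there are at most two, and
the other neighbour of `s` if `m` is a leaf of `G[C]` at a vertex `s` of degree two in `G[C]`. -/
def Near (G : SimpleGraph V) (C : Finset V) (m c : V) : Prop :=
  c = m ∨ G.neighborSet c = {m} ∨ (G.Adj m c ∧ (codeNbrs G C m).card ≤ 2) ∨
    ∃ s, codeNbrs G C m = {s} ∧ codeNbrs G C s = {m, c}

/-- The relation along which vertices `c ∈ C` are charged to vertices `d ∉ C`: either `c` is near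
a vertex marked by `d`, or `d` marks nothing and `c` is one of its exactly two neighbours in `C`. -/
def Charge (G : SimpleGraph V) (C : Finset V) (c d : V) : Prop :=
  (∃ m, Marks G C d m ∧ Near G C m c) ∨
    (∀ m, ¬ Marks G C d m) ∧ c ∈ codeNbrs G C d ∧ (codeNbrs G C d).card = 2

/-- A vertex outside `C` marks at most one vertex. -/
theorem Marks.unique {d c c' : V} (h : Marks G C d c) (h' : Marks G C d c') : c = c' := by
  classical
  obtain ⟨-, h | ⟨h1, w, h2, h3⟩⟩ := h <;> obtain ⟨-, h' | ⟨h1', w', h2', h3'⟩⟩ := h'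
  · rw [h] at h'; simpa using h'
  · rw [h] at h3'
    have h1 : c' ∈ ({c} : Finset V) := by rw [h3']; simp
    exact (Finset.mem_singleton.1 h1).symm
  · rw [h3] at h'
    have h1 : c ∈ ({c'} : Finset V) := by rw [← h']; simp
    simpa using h1
  · have h4 : c ∈ ({c', w'} : Finset V) := by rw [← h3', h3]; simp
    simp only [mem_insert, mem_singleton] at h4
    rcases h4 with h4 | rfl
    · exact h4
    · exact (h1 h2').elim

open Classical in
/-- At most three vertices are near `m`. A leaf `m` of `G[C]` contributes itself, its neighbour `s`
and the other neighbour of `s`; a vertex of degree two in `G[C]` contributes its closed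
neighbourhood; and a vertex of larger degree contributes itself and at most one pendant vertex of
`G`, by twin-freeness. -/
theorem card_near_le (htwin : TwinFree G) (h : IsGood G C) {m : V} (hmC : m ∈ C) :
    ({c ∈ C | Near G C m c} : Finset V).card ≤ 3 := by
  obtain ⟨s, hs⟩ := h.dom m
  have hpos := Finset.card_pos.2 ⟨s, hs⟩
  have hpend : ∀ c, G.neighborSet c = {m} → G.Adj m c ∧ codeNbrs G C c = {m} := fun c hcm => by
    have h1 : ∀ x, G.Adj c x ↔ x = m := fun x => Set.ext_iff.1 hcm x
    exact ⟨((h1 m).2 rfl).symm,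
      codeNbrs_eq_singleton.2 ⟨⟨hmC, (h1 m).2 rfl⟩, fun u _ hu => (h1 u).1 hu⟩⟩
  rcases (by omega : (codeNbrs G C m).card = 1 ∨ (codeNbrs G C m).card = 2 ∨
    3 ≤ (codeNbrs G C m).card) with h1 | h2 | h3
  · obtain ⟨s, hs⟩ := Finset.card_eq_one.1 h1
    obtain ⟨t, ht⟩ : ∃ t, ∀ c, codeNbrs G C s = {m, c} → c = m ∨ c = t := by
      by_cases ht : ∃ t, codeNbrs G C s = {m, t}
      · obtain ⟨t, ht⟩ := ht
        refine ⟨t, fun c hc => ?_⟩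
        have : c ∈ ({m, t} : Finset V) := by rw [← ht, hc]; simp
        simpa using this
      · exact ⟨m, fun c hc => (ht ⟨c, hc⟩).elim⟩
    refine (Finset.card_le_card (t := {m, s, t}) fun c hc => ?_).trans card_le_three
    have hs' := codeNbrs_eq_singleton.1 hs
    simp only [mem_filter, mem_insert, mem_singleton] at hc ⊢
    obtain ⟨hcC, hc | hc | hc | ⟨s', hc, hc'⟩⟩ := hc
    · exact .inl hc
    · obtain ⟨hmc, hcm⟩ := hpend c hc
      obtain rfl := hs'.2 c hcC hmc
      exact (h.big m hmC c hcC hs hcm).elim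
    · exact .inr (.inl (hs'.2 c hcC hc.1))
    · rw [hs] at hc
      obtain rfl := Finset.singleton_injective hc
      rcases ht c hc' with h' | h'
      · exact .inl h'
      · exact .inr (.inr h')
  · refine (Finset.card_le_card (t := insert m (codeNbrs G C m)) fun c hc => ?_).trans
      ((Finset.card_insert_le _ _).trans (by omega))
    simp only [mem_filter, mem_insert, mem_codeNbrs] at hc ⊢
    obtain ⟨hcC, hc | hc | hc | ⟨s', hc, hc'⟩⟩ := hc
    · exact .inl hc
    · exact .inr ⟨hcC, (hpend c hc).1⟩
    · exact .inr ⟨hcC, hc.1⟩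
    · simp [hc] at h2
  · refine (Finset.card_le_card (t := insert m {c ∈ C | G.neighborSet c = {m}})
      fun c hc => ?_).trans ((Finset.card_insert_le _ _).trans ?_)
    · simp only [mem_filter, mem_insert] at hc ⊢
      obtain ⟨hcC, hc | hc | hc | ⟨s', hc, hc'⟩⟩ := hc
      · exact .inl hc
      · exact .inr ⟨hcC, hc⟩
      · omega
      · simp [hc] at h3
    · have : ({c ∈ C | G.neighborSet c = {m}} : Finset V).card ≤ 1 := by
        refine Finset.card_le_one.2 fun a ha b hb => ?_
        simp only [mem_filter] at ha hb
        by_contra hab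
        exact (htwin a b).1 ⟨hab, ha.2.trans hb.2.symm⟩
      omega

open Classical in
theorem card_charge_le (htwin : TwinFree G) (h : IsGood G C) (d : V) :
    ({c ∈ C | Charge G C c d} : Finset V).card ≤ 3 := by
  by_cases hm : ∃ m, Marks G C d m
  · obtain ⟨m, hm⟩ := hm
    have hmC : m ∈ C := by
      obtain ⟨-, h' | ⟨-, w, -, h'⟩⟩ := hm
      · exact (codeNbrs_eq_singleton.1 h').1.1
      · exact (codeNbrs_eq_pair.1 h').1.1
    refine (Finset.card_le_card fun c hc => ?_).trans (card_near_le htwin h hmC)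
    simp only [mem_filter] at hc ⊢
    refine ⟨hc.1, ?_⟩
    rcases hc.2 with ⟨m', hm', hn⟩ | ⟨h', -⟩
    · exact hm.unique hm' ▸ hn
    · exact (h' m hm).elim
  · by_cases h2 : (codeNbrs G C d).card = 2
    · refine (Finset.card_le_card (t := codeNbrs G C d) fun c hc => ?_).trans (by omega)
      simp only [mem_filter] at hc
      rcases hc.2 with ⟨m, hm', -⟩ | h'
      · exact (hm ⟨m, hm'⟩).elim
      · exact h'.2.1
    · rw [Finset.card_eq_zero.2 (Finset.filter_eq_empty_iff.2 ?_)]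
      · omega
      · rintro c - (⟨m, hm', -⟩ | h')
        · exact hm ⟨m, hm'⟩
        · exact h2 h'.2.2

/-- Every vertex of an optimal set can be charged to a vertex outside of it. -/
theorem IsOptimal.exists_charge (hg : 5 ≤ G.egirth) (htwin : TwinFree G)
    (h : IsOptimal G C) {c : V} (hcC : c ∈ C) : ∃ d, d ∉ C ∧ Charge G C c d := by
  classical
  have hmark : ∀ m, Marked G C m → Near G C m c → ∃ d, d ∉ C ∧ Charge G C c d :=
    fun m ⟨d, hd⟩ hn => ⟨d, hd.1, .inl ⟨m, hd, hn⟩⟩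
  by_cases hc : Marked G C c
  · exact hmark c hc (.inl rfl)
  -- Any two vertices of a path component are near each other.
  have hend : ∀ a b, IsPathComp G C a b c → ∃ d, d ∉ C ∧ Charge G C c d := by
    intro a b hP
    have h1 := codeNbrs_eq_singleton.1 hP.2.1
    have h2 := codeNbrs_eq_pair.1 hP.2.2.1
    rcases h.exists_marked_of_isPathComp hg htwin hP with hm | hm | hm
    · exact hmark a hm (.inr (.inr (.inr ⟨b, hP.2.1, hP.2.2.1⟩)))
    · exact hmark b hm (.inr (.inr (.inl ⟨h2.2.1.2, by rw [hP.2.2.1]; exact card_le_two⟩)))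
    · exact (hc hm).elim
  have hmid : ∀ a b, IsPathComp G C a c b → ∃ d, d ∉ C ∧ Charge G C c d := by
    intro a b hP
    have h2 := codeNbrs_eq_pair.1 hP.2.2.1
    rcases h.exists_marked_of_isPathComp hg htwin hP with hm | hm | hm
    · exact hmark a hm (.inr (.inr (.inl ⟨h2.1.2.symm, by rw [hP.2.1]; simp⟩)))
    · exact (hc hm).elim
    · exact hmark b hm (.inr (.inr (.inl ⟨h2.2.1.2.symm, by rw [hP.2.2.2]; simp⟩)))
  rcases h.removal hg hcC hc with ⟨s, hs, hsC⟩ | ⟨s, t, hs, ht, htc⟩ | ⟨w, hw, hcw⟩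
  -- A leaf `s` at `c` is marked, unless `c` is the middle of a path component.
  · have hs' := codeNbrs_eq_singleton.1 hs
    by_cases hsm : Marked G C s
    · exact hmark s hsm (.inr (.inr (.inl ⟨hs'.1.2, by rw [hs]; simp⟩)))
    rcases h.removal hg hsC hsm with ⟨s', h1, h1C⟩ | ⟨s', t, h1, h2, h3⟩ | ⟨w, hw, h1⟩
    · have h1' := codeNbrs_eq_singleton.1 h1
      obtain rfl := hs'.2 s' h1C h1'.1.2.symm
      exact (h.big _ hsC _ hcC hs h1).elim
    · have h1' := codeNbrs_eq_pair.1 h1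
      have h2' := codeNbrs_eq_singleton.1 h2
      obtain rfl := hs'.2 s' h2'.1.1 h1'.2.1.2.symm
      exact hmid t s ⟨h3, h2, h1, hs⟩
    · rw [hs] at h1
      obtain rfl := Finset.singleton_injective h1
      exact (hc (.of_owner hw)).elim
  -- On a pendant path `c`, `s`, `t` one of `s`, `t` is marked, unless `c`, `s`, `t` is a component.
  · have hs' := codeNbrs_eq_pair.1 hs
    have ht' := codeNbrs_eq_singleton.1 ht
    have htC := hs'.1.1
    by_cases htm : Marked G C t
    · exact hmark t htm (.inr (.inr (.inr ⟨s, ht, hs⟩)))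
    rcases h.removal hg htC htm with ⟨s', h1, h1C⟩ | ⟨s', t', h1, h2, h3⟩ | ⟨w, hw, h1⟩
    · have h1' := codeNbrs_eq_singleton.1 h1
      obtain rfl := ht'.2 s' h1C h1'.1.2.symm
      exact (h.big _ htC _ ht'.1.1 ht h1).elim
    · have h1' := codeNbrs_eq_pair.1 h1
      have h2' := codeNbrs_eq_singleton.1 h2
      obtain rfl := ht'.2 s' h2'.1.1 h1'.2.1.2.symm
      obtain rfl := (h1'.2.2 c hcC hs'.2.1.2).resolve_right htc.symm
      exact hend t s' ⟨h3.symm, ht, hs, h2⟩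
    · rw [ht] at h1
      obtain rfl := Finset.singleton_injective h1
      exact hmark s (.of_owner hw) (.inr (.inr (.inl ⟨hs'.2.1.2, by rw [hs]; exact card_le_two⟩)))
  -- A leaf `c` at an owner `w` is pendant in `G` or has a neighbour `x` outside `C`.
  · have hcw' := codeNbrs_eq_singleton.1 hcw
    by_cases hleaf : G.neighborSet c = {w}
    · exact hmark w (.of_owner hw) (.inr (.inl hleaf))
    obtain ⟨x, hcx, hxw⟩ : ∃ x, G.Adj c x ∧ x ≠ w := by
      by_contra! hcon
      exact hleaf (Set.ext fun x => ⟨hcon x, by rintro rfl; exact hcw'.1.2⟩)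
    have hxC : x ∉ C := fun hxC => hxw (hcw'.2 x hxC hcx)
    by_cases hpath : ∃ v, codeNbrs G C v = {w} ∧ codeNbrs G C w = {v, c} ∧ v ≠ c
    · obtain ⟨v, h1, h2, h3⟩ := hpath
      exact hend v w ⟨h3, h1, h2, hcw⟩
    have hcx' : c ∈ codeNbrs G C x := mem_codeNbrs.2 ⟨hcC, hcx.symm⟩
    -- With a third neighbour in `C`, the vertex `x` could replace `c`.
    have hle : (codeNbrs G C x).card ≤ 2 := by
      by_contra! hlt
      refine h.swap hg hcC hc hcw hxC ?_ (fun _ => hcx.symm) fun v h1 h2 => ?_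
      · have : codeNbrs G (C.erase c) x = (codeNbrs G C x).erase c := by
          ext; simp only [mem_codeNbrs, mem_erase]; tauto
        rw [this, Finset.card_erase_of_mem hcx']
        omega
      · by_contra hxv
        exact hpath ⟨v, h1, h2, by rintro rfl; exact hxv hcx.symm⟩
    -- Since `c` is unmarked, `x` is not private to `c`, and it marks nothing else either.
    have hne : (codeNbrs G C x).card ≠ 1 := fun h1 => by
      obtain ⟨e, he⟩ := Finset.card_eq_one.1 h1
      rw [he, mem_singleton] at hcx'
      exact hc ⟨x, hxC, .inl (hcx' ▸ he)⟩
    have hpos := Finset.card_pos.2 ⟨c, hcx'⟩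
    refine ⟨x, hxC, .inr ⟨fun m hm => ?_, hcx', by omega⟩⟩
    obtain ⟨-, hm' | ⟨h1, w', h2, h3⟩⟩ := id hm
    · exact hne (by rw [hm']; simp)
    · rw [h3] at hcx'
      simp only [mem_insert, mem_singleton] at hcx'
      rcases hcx' with rfl | rfl
      · exact hc ⟨x, hm⟩
      · exact hc (.of_owner h2)

theorem IsOptimal.four_mul_card_le [Fintype V] (hg : 5 ≤ G.egirth) (htwin : TwinFree G)
    (h : IsOptimal G C) : 4 * C.card ≤ 3 * Fintype.card V := by
  classical
  choose! f hf using fun c hc => h.exists_charge hg htwin (c := c) hc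
  have := Finset.card_le_mul_card_image_of_maps_to (s := C) (t := Cᶜ) (f := f)
    (fun c hc => by simpa using (hf c hc).1) 3 fun d _ =>
      (Finset.card_le_card fun c hc => by
        simp only [mem_filter] at hc ⊢
        exact ⟨hc.1, hc.2 ▸ (hf c hc.1).2⟩).trans (card_charge_le htwin h.toIsGood d)
  rw [Finset.card_compl] at this
  have := Finset.card_le_univ C
  omega

end TotalDomIdCode

theorem mainTheorem2 {V : Type*} [Fintype V] (G : SimpleGraph V)
    (hn : 3 ≤ Fintype.card V) (hconn : G.Connected)
    (htwin : TotalDomIdCode.TwinFree G) (hgirth : 5 ≤ G.egirth) :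
    (∃ C : Finset V, TotalDomIdCode.IsTotalDominatingIdentifyingCode G C) ∧
      (TotalDomIdCode.gammaTID G : ℝ) ≤ 3 * (Fintype.card V : ℝ) / 4 := by
  classical
  obtain ⟨C, hC⟩ := (TotalDomIdCode.isGood_univ hn hconn htwin).exists_isOptimal
  have hcode := hC.toIsGood.isCode hgirth
  refine ⟨⟨C, hcode⟩, ?_⟩
  have h1 : TotalDomIdCode.gammaTID G ≤ C.card := Nat.sInf_le ⟨C, hcode, rfl⟩
  have h2 := hC.four_mul_card_le hgirth htwin
  rify at h1 h2
  linarith
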